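/- Let $\mathbb{G}$ be a homogeneous group, i.e. $\mathbb{R}^N$ ($N\ge 1$) with a Lie group law for which, for some $v_1,\dots,v_N>0$, all dilations $D_\lambda(x)=(\lambda^{v_1}x_1,\dots,\lambda^{v_N}x_N)$, $\lambda>0$, are group automorphisms. Let $|\cdot|$ be a quasi-norm on $\mathbb{G}$, i.e. a continuous function $\mathbb{G}\to[0,\infty)$ with $|x^{-1}|=|x|$, $|D_\lambda x|=\lambda|x|$ for $\lambda>0$, and $|x|=0\iff x=0$. Let $dx$ be the Haar measure of $\mathbb{G}$ (Lebesgue measure on $\mathbb{R}^N$), $\mathbb{B}(0,r)=\{y\in\mathbb{G}:|y|<r\}$, and write $|\mathbb{B}(0,r)|$ for the volume of this quasi-ball. Let $0<p\le q<\infty$, $a,b\in\mathbb{R}$ and $\epsilon>0$. Consider, for a constant $C\in[0,\infty)$, the inequality $$\left(\int_{\mathbb{G}}\left[\exp\left(\epsilon\,|\mathbb{B}(0,|x|)|^{\epsilon}\int_{\mathbb{G}\setminus\mathbb{B}(0,|x|)}|\mathbb{B}(0,|y|)|^{-\epsilon-1}\log f(y)\,dy\right)\right]^q|\mathbb{B}(0,|x|)|^a\,dx\right)^{1/q}\le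 C\left(\int_{\mathbb{G}}f(x)^p\,|\mathbb{B}(0,|x|)|^b\,dx\right)^{1/p},\qquad(*)$$ where both sides may be infinite, the inner integral is taken in $[-\infty,\infty]$, and $\exp(-\infty)=0$. Then there is a finite constant $C$ such that $(*)$ holds for all positive measurable functions $f$ on $\mathbb{G}$ if and only if $$p(a+1)-q(b+1)=0.$$ Moreover, in this case there is a least constant $C$ such that $(*)$ holds for all such $f$, and it satisfies $$\left(\frac pq\right)^{1/q}\epsilon^{\frac1p-\frac1q}\exp\left(-\frac{b+1}{\epsilon p}-\frac1p\right)\le C\le\left(\frac pq\right)^{1/q}\epsilon^{\frac1p-\frac1q}\exp\left(-\frac{b+1}{\epsilon p}\right).$$ -/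

import Mathlib

open MeasureTheory
open scoped ENNReal NNReal ContDiff Manifold

/-- The dilation `D_r (x₁, …, x_N) = (r ^ v₁ * x₁, …, r ^ v_N * x_N)` of `ℝ^N`. -/
noncomputable def dilation {N : ℕ} (v : Fin N → ℝ) (r : ℝ) (x : EuclideanSpace ℝ (Fin N)) :
    EuclideanSpace ℝ (Fin N) :=
  WithLp.toLp 2 (fun i => r ^ v i * x i)

/-- A homogeneous (Lie) group whose underlying manifold is `ℝ^N`: a smooth group law on `ℝ^N`
(written multiplicatively, unrelated to vector addition) and positive exponents `v₁, …, v_N` such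
that every dilation `D_r`, `r > 0`, is an automorphism of the group. (Each `D_r` is a linear
bijection of `ℝ^N`, so only multiplicativity has to be required.) -/
structure HomogeneousGroup (N : ℕ) where
  group : Group (EuclideanSpace ℝ (Fin N))
  lieGroup : LieGroup 𝓘(ℝ, EuclideanSpace ℝ (Fin N)) ∞ (EuclideanSpace ℝ (Fin N))
  weight : Fin N → ℝ
  weight_pos : ∀ i, 0 < weight i
  dilation_mul : ∀ r : ℝ, 0 < r → ∀ x y : EuclideanSpace ℝ (Fin N),
    dilation weight r (x * y) = dilation weight r x * dilation weight r y

/-- A quasi-norm on a homogeneous group: a continuous non-negative function which is invariant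
under the inversion of the group, homogeneous of degree one with respect to the dilations, and
vanishes only at the origin. -/
structure QuasiNorm {N : ℕ} (G : HomogeneousGroup N) where
  toFun : EuclideanSpace ℝ (Fin N) → ℝ
  continuous_toFun : Continuous toFun
  nonneg : ∀ x, 0 ≤ toFun x
  inv_eq : ∀ x, toFun (G.group.inv x) = toFun x
  dilation_eq : ∀ r : ℝ, 0 < r → ∀ x, toFun (dilation G.weight r x) = r * toFun x
  eq_zero_iff : ∀ x, toFun x = 0 ↔ x = 0

namespace QuasiNorm

variable {N : ℕ} {G : HomogeneousGroup N}

/-- The quasi-ball `𝔹(0, r)` centred at the origin. -/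
def ball (ν : QuasiNorm G) (r : ℝ) : Set (EuclideanSpace ℝ (Fin N)) :=
  {y | ν.toFun y < r}

/-- The volume `|𝔹(0, |x|)|`. The Haar measure of the group is Lebesgue measure on `ℝ^N`. -/
noncomputable def ballVol (ν : QuasiNorm G) (x : EuclideanSpace ℝ (Fin N)) : ℝ :=
  volume.real (ν.ball (ν.toFun x))

end QuasiNorm

/-- The Lebesgue integral `∫ g⁺ - ∫ g⁻` of a real function over the set `s`, with values in
`[-∞, ∞]`. In particular it is `-∞` when `g⁺` is integrable and `g⁻` is not, rather than the
default value `0` of the Bochner integral. -/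
noncomputable def extIntegral {α : Type*} [MeasurableSpace α] (μ : Measure α) (s : Set α)
    (g : α → ℝ) : EReal :=
  ((∫⁻ y in s, ENNReal.ofReal (g y) ∂μ : ℝ≥0∞) : EReal)
    - ((∫⁻ y in s, ENNReal.ofReal (-g y) ∂μ : ℝ≥0∞) : EReal)

/-- The conjugate exponential averaging operator
`exp (ε |𝔹(0,|x|)|^ε ∫_{𝔾 ∖ 𝔹(0,|x|)} |𝔹(0,|y|)|^(-ε-1) log f(y) dy)`, with `exp (-∞) = 0` and
`exp ∞ = ∞`. -/
noncomputable def conjExpMean {N : ℕ} {G : HomogeneousGroup N} (ν : QuasiNorm G) (ε : ℝ)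
    (f : EuclideanSpace ℝ (Fin N) → ℝ) (x : EuclideanSpace ℝ (Fin N)) : ℝ≥0∞ :=
  EReal.exp (((ε * ν.ballVol x ^ ε : ℝ) : EReal) *
    extIntegral volume (ν.ball (ν.toFun x))ᶜ
      (fun y => ν.ballVol y ^ (-ε - 1) * Real.log (f y)))

/-- The conjugate Levin-Cochran-Lee inequality with power weights and constant `C`, for all
positive measurable functions `f`. Both sides take values in `[0, ∞]`. -/
def ConjLevinCochranLee {N : ℕ} {G : HomogeneousGroup N} (ν : QuasiNorm G)
    (p q a b ε : ℝ) (C : ℝ≥0) : Prop :=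
  ∀ f : EuclideanSpace ℝ (Fin N) → ℝ, AEMeasurable f volume → (∀ x, 0 < f x) →
    (∫⁻ x, conjExpMean ν ε f x ^ q * ENNReal.ofReal (ν.ballVol x ^ a)) ^ (1 / q)
      ≤ (C : ℝ≥0∞) * (∫⁻ x, ENNReal.ofReal (f x ^ p * ν.ballVol x ^ b)) ^ (1 / p)

/-! By homogeneity the quasi-ball of radius `r` has volume `c r^Q`, with `0 < c < ∞` and `Q` the sum
of the weights. Hence `V(x) = |𝔹(0,|x|)|` pushes Lebesgue measure forward to Lebesgue measure on
`(0,∞)` (`measurePreserving_ballVol`). Complements of balls are superlevel sets of `V`, so the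
problem depends on the group only through this one property of `V`.

Upper bound: `ε t^ε V^(-ε-1)` is a probability density on `{V ≥ t}`. Jensen's inequality for `f^p
V^(b+1)` (`exp_extIntegral_rpow_le`) replaces the exponential mean by a tail integral of `V^(-ε)
(f^p V^b)`. Minkowski's inequality with exponent `q/p ≥ 1`
(`lintegral_rpow_mul_setLIntegral_Ici_rpow_le`) bounds the resulting norm and gives the stated
constant.

Lower bound and necessity: a power of `V` on `{V ≥ R}`, continued inwards with negligible cost, has
an explicit mean there (`levinCochranLee_powerTest`). Fixing `R = 1` loses only the factor
`exp(-1/p)`; varying `R` forces the relation between the exponents. A least constant exists because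
the inequality survives limits in `C`. -/

namespace QuasiNorm

variable {N : ℕ} {G : HomogeneousGroup N}

/-! ### Volumes of quasi-balls -/

theorem continuous_dilation_left {v : Fin N → ℝ} (hv : ∀ i, 0 < v i)
    (x : EuclideanSpace ℝ (Fin N)) : Continuous fun r : ℝ => dilation v r x := by
  unfold dilation
  refine (PiLp.continuous_toLp 2 _).comp (continuous_pi fun i => ?_)
  exact (continuous_id.rpow_const fun r => Or.inr (hv i).le).mul continuous_const

theorem dilation_eq_toLpLin (v : Fin N → ℝ) (r : ℝ) :
    dilation v r = Matrix.toLpLin 2 2 (Matrix.diagonal fun i => r ^ v i) := by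
  funext x
  ext i
  simp [dilation, Matrix.toLpLin_apply, Matrix.mulVec_diagonal]

theorem volume_dilation_preimage (v : Fin N → ℝ) {r : ℝ} (hr : 0 < r)
    (s : Set (EuclideanSpace ℝ (Fin N))) :
    volume (dilation v r ⁻¹' s) = ENNReal.ofReal (r ^ (-∑ i, v i)) * volume s := by
  have hdet : LinearMap.det (Matrix.toLpLin 2 2 (Matrix.diagonal fun i => r ^ v i)) =
      r ^ ∑ i, v i := by
    rw [LinearMap.det_toLpLin, Matrix.det_diagonal, Real.rpow_sum_of_pos hr]
  rw [dilation_eq_toLpLin, Measure.addHaar_preimage_linearMap _ (by rw [hdet]; positivity), hdet,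
    Real.rpow_neg hr.le, abs_of_pos (by positivity)]

/-- The homogeneous dimension. -/
noncomputable def homDim (G : HomogeneousGroup N) : ℝ := ∑ i, G.weight i

theorem homDim_pos (hN : 0 < N) (G : HomogeneousGroup N) : 0 < homDim G :=
  Finset.sum_pos (fun i _ => G.weight_pos i) ⟨⟨0, hN⟩, Finset.mem_univ _⟩

theorem volume_ball (ν : QuasiNorm G) {r : ℝ} (hr : 0 < r) :
    volume (ν.ball r) = ENNReal.ofReal (r ^ homDim G) * volume (ν.ball 1) := by
  have h : ν.ball r = dilation G.weight r⁻¹ ⁻¹' ν.ball 1 := by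
    ext x
    simp only [ball, Set.mem_ofPred_eq, Set.mem_preimage, ν.dilation_eq _ (inv_pos.2 hr)]
    rw [inv_mul_lt_iff₀ hr, mul_one]
  rw [h, volume_dilation_preimage _ (inv_pos.2 hr), Real.inv_rpow hr.le, Real.rpow_neg hr.le,
    inv_inv, homDim]

/-- Take `m` to be a positive lower bound of the quasi-norm on the Euclidean unit sphere. If `‖x‖ >
1`, the path `s ↦ D_s x` from `0` to `x` crosses the sphere at some `0 < s ≤ 1`, so `m ≤ s |x| ≤
|x|`. This makes small quasi-balls bounded, and scaling then gives every quasi-ball finite volume.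
-/
theorem exists_ball_subset (ν : QuasiNorm G) :
    ∃ m > 0, ν.ball m ⊆ Metric.closedBall 0 1 := by
  obtain ⟨m, hm, h⟩ := (isCompact_sphere (0 : EuclideanSpace ℝ (Fin N)) 1).exists_forall_le'
    ν.continuous_toFun.continuousOn (a := 0) (fun x hx => by
      refine lt_of_le_of_ne (ν.nonneg x) fun h0 => ?_
      rw [(ν.eq_zero_iff x).1 h0.symm] at hx
      simp at hx)
  refine ⟨m, hm, fun x hx => ?_⟩
  by_contra hx1
  simp only [Metric.mem_closedBall, dist_zero_right, not_le] at hx1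
  have hzero : dilation G.weight 0 x = 0 := by
    ext i
    simp [dilation, Real.zero_rpow (G.weight_pos i).ne']
  have hone : dilation G.weight 1 x = x := by
    ext i
    simp [dilation]
  obtain ⟨s, hs, hs1⟩ := intermediate_value_Icc (zero_le_one' ℝ)
    (continuous_dilation_left G.weight_pos x).norm.continuousOn
    (show (1 : ℝ) ∈ Set.Icc _ _ by simp [hzero, hone, hx1.le])
  have hs0 : 0 < s := by
    refine lt_of_le_of_ne hs.1 fun h0 => ?_
    subst h0
    simp [hzero] at hs1
  have h1 := h (dilation G.weight s x) (by simpa using hs1)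
  rw [ν.dilation_eq s hs0] at h1
  have h2 : ν.toFun x < m := hx
  nlinarith [ν.nonneg x, hs.2]

theorem volume_ball_one_lt_top (ν : QuasiNorm G) : volume (ν.ball 1) < ⊤ := by
  obtain ⟨m, hm, h⟩ := ν.exists_ball_subset
  have h1 : volume (ν.ball m) < ⊤ :=
    (measure_mono h).trans_lt (isCompact_closedBall _ _).measure_lt_top
  rw [ν.volume_ball hm] at h1
  refine ENNReal.lt_top_of_mul_ne_top_right h1.ne ?_
  simpa using Real.rpow_pos_of_pos hm _

theorem volume_ball_one_pos (ν : QuasiNorm G) : 0 < volume (ν.ball 1) := by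
  refine (isOpen_lt ν.continuous_toFun continuous_const).measure_pos _ ⟨0, ?_⟩
  simp [(ν.eq_zero_iff 0).2 rfl]

theorem volume_real_ball (hN : 0 < N) (ν : QuasiNorm G) {r : ℝ} (hr : 0 ≤ r) :
    volume.real (ν.ball r) = volume.real (ν.ball 1) * r ^ homDim G := by
  rcases hr.eq_or_lt with rfl | hr
  · have : ν.ball 0 = ∅ := by
      ext x
      simp [ball, ν.nonneg x]
    rw [this, Real.zero_rpow (homDim_pos hN G).ne']
    simp
  · simp only [Measure.real]
    rw [ν.volume_ball hr, ENNReal.toReal_mul, ENNReal.toReal_ofReal (by positivity), mul_comm]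

theorem volume_real_ball_one_pos (ν : QuasiNorm G) : 0 < volume.real (ν.ball 1) :=
  ENNReal.toReal_pos ν.volume_ball_one_pos.ne' ν.volume_ball_one_lt_top.ne

theorem ballVol_eq (hN : 0 < N) (ν : QuasiNorm G) (x : EuclideanSpace ℝ (Fin N)) :
    ν.ballVol x = volume.real (ν.ball 1) * ν.toFun x ^ homDim G :=
  volume_real_ball hN ν (ν.nonneg x)

theorem ballVol_le_iff (hN : 0 < N) (ν : QuasiNorm G) (x y : EuclideanSpace ℝ (Fin N)) :
    ν.ballVol x ≤ ν.ballVol y ↔ ν.toFun x ≤ ν.toFun y := by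
  rw [ballVol_eq hN, ballVol_eq hN, mul_le_mul_iff_right₀ ν.volume_real_ball_one_pos,
    Real.rpow_le_rpow_iff (ν.nonneg x) (ν.nonneg y) (homDim_pos hN G)]

theorem compl_ball_eq (hN : 0 < N) (ν : QuasiNorm G) (x : EuclideanSpace ℝ (Fin N)) :
    (ν.ball (ν.toFun x))ᶜ = ν.ballVol ⁻¹' Set.Ici (ν.ballVol x) := by
  ext y
  simp [ball, ballVol_le_iff hN]

theorem measurable_ballVol (hN : 0 < N) (ν : QuasiNorm G) : Measurable ν.ballVol := by
  rw [show ν.ballVol = fun x => volume.real (ν.ball 1) * ν.toFun x ^ homDim G from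
    funext (ballVol_eq hN ν)]
  exact (ν.continuous_toFun.measurable.pow_const _).const_mul _

theorem volume_ballVol_preimage_Iio (hN : 0 < N) (ν : QuasiNorm G) (t : ℝ) :
    volume (ν.ballVol ⁻¹' Set.Iio t) = ENNReal.ofReal t := by
  have hc := ν.volume_real_ball_one_pos
  have hQ := homDim_pos hN G
  rcases le_or_gt t 0 with ht | ht
  · rw [ENNReal.ofReal_of_nonpos ht, show ν.ballVol ⁻¹' Set.Iio t = ∅ from ?_, measure_empty]
    ext x
    simpa using ht.trans (show 0 ≤ ν.ballVol x from measureReal_nonneg)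
  -- The radius is the solution of `c r^Q = t`, so that `{V < t}` is a quasi-ball of volume `t`.
  · set r := (t / volume.real (ν.ball 1)) ^ (homDim G)⁻¹ with hr
    have hr0 : 0 < r := by positivity
    have hrQ : volume.real (ν.ball 1) * r ^ homDim G = t := by
      rw [hr, Real.rpow_inv_rpow (by positivity) hQ.ne']
      field_simp
    have : ν.ballVol ⁻¹' Set.Iio t = ν.ball r := by
      ext x
      rw [Set.mem_preimage, Set.mem_Iio, ballVol_eq hN, ← hrQ, mul_lt_mul_iff_right₀ hc,
        Real.rpow_lt_rpow_iff (ν.nonneg x) hr0.le hQ]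
      rfl
    rw [this, ν.volume_ball hr0, ← hrQ, mul_comm, ENNReal.ofReal_mul hc.le, Measure.real,
      ENNReal.ofReal_toReal ν.volume_ball_one_lt_top.ne]

/-- The set `{V < t}` has measure `t` for `t ≥ 0`; differences of such sets give all half-open
intervals, which determine the image measure. -/
theorem measurePreserving_ballVol (hN : 0 < N) (ν : QuasiNorm G) :
    MeasurePreserving ν.ballVol volume (volume.restrict (Set.Ioi 0)) := by
  refine ⟨measurable_ballVol hN ν, Eq.symm (Measure.ext_of_Ico _ _ fun a b hab => ?_)⟩
  rw [Measure.map_apply (measurable_ballVol hN ν) measurableSet_Ico,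
    ← Set.Iio_sdiff_Iio, Set.preimage_sdiff, measure_sdiff
      (Set.preimage_mono (Set.Iio_subset_Iio hab.le))
      (measurable_ballVol hN ν measurableSet_Iio).nullMeasurableSet
      (by rw [volume_ballVol_preimage_Iio hN]; exact ENNReal.ofReal_ne_top),
    volume_ballVol_preimage_Iio hN, volume_ballVol_preimage_Iio hN, Set.Iio_sdiff_Iio,
    restrict_Ioi_eq_restrict_Ici, Measure.restrict_apply measurableSet_Ico, Set.Ico_inter_Ici,
    Real.volume_Ico]
  rcases le_total a 0 with ha | ha
  · simp [max_eq_right ha, ENNReal.ofReal_of_nonpos ha]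
  · rw [max_eq_left ha, ENNReal.ofReal_sub _ ha]

end QuasiNorm

/-! ### Power and logarithm integrals on half-lines -/

/-- Subtracting `log t` makes the integrand nonnegative on `(t, ∞)`, so integrability follows from
the limit of the antiderivative alone. The uncentred integral is recovered by adding back a multiple
of `s^(-ε-1)`. -/
theorem hasDerivAt_neg_rpow_mul_log_sub {ε t s : ℝ} (hε : 0 < ε) (hs : 0 < s) :
    HasDerivAt (fun s => -(s ^ (-ε) * ((Real.log s - Real.log t) / ε + 1 / ε ^ 2)))
      (s ^ (-ε - 1) * (Real.log s - Real.log t)) s := by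
  have h1 : HasDerivAt (fun s : ℝ => s ^ (-ε)) (-ε * s ^ (-ε - 1)) s :=
    Real.hasDerivAt_rpow_const (Or.inl hs.ne')
  have h2 : HasDerivAt (fun s => (Real.log s - Real.log t) / ε + 1 / ε ^ 2) (s⁻¹ / ε) s :=
    (((Real.hasDerivAt_log hs.ne').sub_const _).div_const _).add_const _
  convert! (h1.mul h2).neg using 1
  have h3 : s ^ (-ε) = s ^ (-ε - 1) * s := by
    rw [← Real.rpow_add_one hs.ne']
    ring_nf
  rw [h3]
  field_simp
  ring

theorem tendsto_neg_rpow_mul_log_sub {ε : ℝ} (t : ℝ) (hε : 0 < ε) :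
    Filter.Tendsto (fun s => -(s ^ (-ε) * ((Real.log s - Real.log t) / ε + 1 / ε ^ 2)))
      Filter.atTop (nhds 0) := by
  have h1 : Filter.Tendsto (fun s : ℝ => Real.log s / s ^ ε) Filter.atTop (nhds 0) :=
    (isLittleO_log_rpow_atTop hε).tendsto_div_nhds_zero
  have h2 := tendsto_rpow_neg_atTop hε
  have h3 := ((h1.div_const ε).add (h2.mul_const (1 / ε ^ 2 - Real.log t / ε))).neg
  simp only [zero_div, zero_mul, add_zero, neg_zero] at h3
  refine h3.congr' ?_
  filter_upwards [Filter.eventually_gt_atTop 0] with s hs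
  rw [Real.rpow_neg hs.le]
  field_simp
  ring

theorem integrableOn_rpow_mul_log_sub {ε t : ℝ} (hε : 0 < ε) (ht : 0 < t) :
    IntegrableOn (fun s => s ^ (-ε - 1) * (Real.log s - Real.log t)) (Set.Ioi t) := by
  refine integrableOn_Ioi_deriv_of_nonneg
    (hasDerivAt_neg_rpow_mul_log_sub hε ht).continuousAt.continuousWithinAt
    (fun s hs => hasDerivAt_neg_rpow_mul_log_sub hε (ht.trans hs)) (fun s hs => ?_)
    (tendsto_neg_rpow_mul_log_sub t hε)
  have hs0 : 0 < s := ht.trans hs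
  exact mul_nonneg (by positivity) (sub_nonneg.2 (Real.log_le_log ht (le_of_lt hs)))

theorem integral_rpow_mul_log_sub {ε t : ℝ} (hε : 0 < ε) (ht : 0 < t) :
    ∫ s in Set.Ioi t, s ^ (-ε - 1) * (Real.log s - Real.log t) = t ^ (-ε) / ε ^ 2 := by
  rw [integral_Ioi_of_hasDerivAt_of_tendsto
    (hasDerivAt_neg_rpow_mul_log_sub hε ht).continuousAt.continuousWithinAt
    (fun s hs => hasDerivAt_neg_rpow_mul_log_sub hε (ht.trans hs))
    (integrableOn_rpow_mul_log_sub hε ht) (tendsto_neg_rpow_mul_log_sub t hε)]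
  simp [div_eq_mul_inv]

theorem integral_Ioi_rpow_neg_sub_one {ε t : ℝ} (hε : 0 < ε) (ht : 0 < t) :
    ∫ s in Set.Ioi t, s ^ (-ε - 1) = t ^ (-ε) / ε := by
  rw [integral_Ioi_rpow_of_lt (by linarith) ht]
  simp [neg_div_neg_eq]

theorem integrableOn_rpow_mul_log {ε t : ℝ} (hε : 0 < ε) (ht : 0 < t) :
    IntegrableOn (fun s => s ^ (-ε - 1) * Real.log s) (Set.Ioi t) := by
  refine ((integrableOn_rpow_mul_log_sub hε ht).add
    ((integrableOn_Ioi_rpow_of_lt (a := -ε - 1) (by linarith) ht).mul_const (Real.log t))).congr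
      (ae_of_all _ fun s => ?_)
  simp
  ring

theorem integral_rpow_mul_log {ε t : ℝ} (hε : 0 < ε) (ht : 0 < t) :
    ∫ s in Set.Ioi t, s ^ (-ε - 1) * Real.log s = t ^ (-ε) / ε * (Real.log t + 1 / ε) := by
  have h := integral_add (integrableOn_rpow_mul_log_sub hε ht)
    ((integrableOn_Ioi_rpow_of_lt (a := -ε - 1) (by linarith) ht).mul_const (Real.log t))
  rw [integral_rpow_mul_log_sub hε ht, integral_mul_const,
    integral_Ioi_rpow_neg_sub_one hε ht] at h
  calc _ = _ := by
        congr 1 with s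
        show _ = s ^ (-ε - 1) * (Real.log s - Real.log t) + s ^ (-ε - 1) * Real.log t
        ring
    _ = _ := h
    _ = _ := by
        field_simp
        ring

theorem setLIntegral_Ioc_rpow {β v : ℝ} (hβ : 0 < β) (hv : 0 ≤ v) :
    ∫⁻ t in Set.Ioc 0 v, ENNReal.ofReal (t ^ (β - 1)) = ENNReal.ofReal (v ^ β / β) := by
  have hint : IntegrableOn (fun t : ℝ => t ^ (β - 1)) (Set.Ioc 0 v) :=
    (intervalIntegrable_iff_integrableOn_Ioc_of_le hv).1
      (intervalIntegral.intervalIntegrable_rpow' (by linarith))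
  rw [← ofReal_integral_eq_lintegral_ofReal hint
    ((ae_restrict_mem measurableSet_Ioc).mono fun t ht => Real.rpow_nonneg ht.1.le _),
    ← intervalIntegral.integral_of_le hv, integral_rpow (Or.inl (by linarith))]
  simp [Real.zero_rpow hβ.ne']

theorem setLIntegral_Ioi_rpow {β t : ℝ} (hβ : 0 < β) (ht : 0 < t) :
    ∫⁻ s in Set.Ioi t, ENNReal.ofReal (s ^ (-β - 1)) = ENNReal.ofReal (t ^ (-β) / β) := by
  rw [← ofReal_integral_eq_lintegral_ofReal (integrableOn_Ioi_rpow_of_lt (by linarith) ht)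
    ((ae_restrict_mem measurableSet_Ioi).mono fun s hs => Real.rpow_nonneg (ht.trans hs).le _),
    integral_Ioi_rpow_neg_sub_one hβ ht]

/-! ### Extended integrals and Jensen's inequality -/

section Preserving

variable {X : Type*} [MeasurableSpace X] {μ : Measure X} {V : X → ℝ}

theorem MeasureTheory.MeasurePreserving.restrict_Ici
    (hV : MeasurePreserving V μ (volume.restrict (Set.Ioi 0))) {t : ℝ} (ht : 0 < t) :
    MeasurePreserving V (μ.restrict (V ⁻¹' Set.Ici t)) (volume.restrict (Set.Ioi t)) := by
  have h := hV.restrict_preimage (measurableSet_Ici (a := t))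
  rwa [Measure.restrict_restrict measurableSet_Ici,
    Set.inter_eq_left.2 (Set.Ici_subset_Ioi.2 ht), ← restrict_Ioi_eq_restrict_Ici] at h

theorem MeasureTheory.MeasurePreserving.ae_pos
    (hV : MeasurePreserving V μ (volume.restrict (Set.Ioi 0))) : ∀ᵐ x ∂μ, 0 < V x :=
  hV.quasiMeasurePreserving.ae (ae_restrict_mem measurableSet_Ioi)

theorem extIntegral_of_integrableOn {s : Set X} {g : X → ℝ} (hg : IntegrableOn g s μ) :
    extIntegral μ s g = ((∫ y in s, g y ∂μ : ℝ) : EReal) := by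
  rw [extIntegral, integral_eq_lintegral_pos_part_sub_lintegral_neg_part hg, EReal.coe_sub,
    EReal.coe_ennreal_toReal hg.lintegral_lt_top.ne,
    EReal.coe_ennreal_toReal (Integrable.lintegral_lt_top (f := fun y => -g y) hg.neg).ne]

theorem extIntegral_eq_bot {s : Set X} {g : X → ℝ} (hm : AEMeasurable g (μ.restrict s))
    (hpos : ∫⁻ y in s, ENNReal.ofReal (g y) ∂μ ≠ ⊤) (hg : ¬ IntegrableOn g s μ) :
    extIntegral μ s g = ⊥ := by
  have hneg : ∫⁻ y in s, ENNReal.ofReal (-g y) ∂μ = ⊤ := by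
    by_contra hneg
    refine hg ⟨hm.aestronglyMeasurable, ?_⟩
    refine (lintegral_mono (g := fun y => ENNReal.ofReal (g y) + ENNReal.ofReal (-g y))
      fun y => ?_).trans_lt ?_
    · rw [Real.enorm_eq_ofReal_abs]
      rcases le_total 0 (g y) with h | h
      · simp [abs_of_nonneg h]
      · simp [abs_of_nonpos h]
    · rw [lintegral_add_left' hm.ennreal_ofReal]
      exact ENNReal.add_lt_top.2 ⟨hpos.lt_top, (Ne.lt_top hneg)⟩
  rw [extIntegral, hneg, EReal.coe_ennreal_top, EReal.sub_top]

/-- Jensen by the tangent line of `exp` at the mean `A`: `e^A (1 + log h - A) ≤ h`. Integrated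
against `w`, the left side is exactly `e^A`. -/
theorem exp_integral_mul_log_le {w h : X → ℝ} (hw0 : ∀ᵐ x ∂μ, 0 ≤ w x) (hw : Integrable w μ)
    (hw1 : ∫ x, w x ∂μ = 1) (hh : ∀ᵐ x ∂μ, 0 < h x)
    (hlog : Integrable (fun x => w x * Real.log (h x)) μ)
    (hint : Integrable (fun x => w x * h x) μ) :
    Real.exp (∫ x, w x * Real.log (h x) ∂μ) ≤ ∫ x, w x * h x ∂μ := by
  set A := ∫ x, w x * Real.log (h x) ∂μ with hA
  have key : ∫ x, Real.exp A * (w x * (1 - A) + w x * Real.log (h x)) ∂μ = Real.exp A := by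
    rw [integral_const_mul, integral_add (hw.mul_const _) hlog, integral_mul_const, hw1, ← hA]
    ring
  rw [← key]
  refine integral_mono_ae (((hw.mul_const _).add hlog).const_mul _) hint ?_
  filter_upwards [hw0, hh] with x hx hhx
  have h1 := Real.add_one_le_exp (Real.log (h x) - A)
  rw [Real.exp_sub, Real.exp_log hhx, le_div_iff₀ (Real.exp_pos A)] at h1
  calc _ = w x * ((Real.log (h x) - A + 1) * Real.exp A) := by ring
    _ ≤ _ := mul_le_mul_of_nonneg_left h1 hx

theorem integrableOn_rpow_neg_sub_one_comp
    (hV : MeasurePreserving V μ (volume.restrict (Set.Ioi 0))) {t ε : ℝ} (ht : 0 < t)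
    (hε : 0 < ε) : IntegrableOn (fun y => V y ^ (-ε - 1)) (V ⁻¹' Set.Ici t) μ :=
  ((hV.restrict_Ici ht).integrable_comp (g := fun s : ℝ => s ^ (-ε - 1))
    (by fun_prop)).2 (integrableOn_Ioi_rpow_of_lt (by linarith) ht)

theorem setIntegral_rpow_neg_sub_one_comp
    (hV : MeasurePreserving V μ (volume.restrict (Set.Ioi 0))) {t ε : ℝ} (ht : 0 < t)
    (hε : 0 < ε) : ∫ y in V ⁻¹' Set.Ici t, V y ^ (-ε - 1) ∂μ = t ^ (-ε) / ε := by
  rw [← integral_Ioi_rpow_neg_sub_one hε ht, ← (hV.restrict_Ici ht).map_eq,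
    integral_map hV.measurable.aemeasurable (by fun_prop)]

theorem integrableOn_rpow_mul_log_comp
    (hV : MeasurePreserving V μ (volume.restrict (Set.Ioi 0))) {t ε : ℝ} (ht : 0 < t)
    (hε : 0 < ε) :
    IntegrableOn (fun y => V y ^ (-ε - 1) * Real.log (V y)) (V ⁻¹' Set.Ici t) μ :=
  ((hV.restrict_Ici ht).integrable_comp (g := fun s : ℝ => s ^ (-ε - 1) * Real.log s)
    (by fun_prop)).2 (integrableOn_rpow_mul_log hε ht)

theorem setIntegral_rpow_mul_log_comp
    (hV : MeasurePreserving V μ (volume.restrict (Set.Ioi 0))) {t ε : ℝ} (ht : 0 < t)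
    (hε : 0 < ε) :
    ∫ y in V ⁻¹' Set.Ici t, V y ^ (-ε - 1) * Real.log (V y) ∂μ =
      t ^ (-ε) / ε * (Real.log t + 1 / ε) := by
  rw [← integral_rpow_mul_log hε ht, ← (hV.restrict_Ici ht).map_eq,
    integral_map hV.measurable.aemeasurable (by fun_prop)]

/-- Jensen's inequality for the exponential mean over `{V ≥ t}`, with a power weight. -/
theorem exp_extIntegral_rpow_le (hV : MeasurePreserving V μ (volume.restrict (Set.Ioi 0)))
    {t ε p : ℝ} (γ : ℝ) (ht : 0 < t) (hε : 0 < ε) (hp : 0 < p) {f : X → ℝ}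
    (hf : AEMeasurable f μ) (hf0 : ∀ x, 0 < f x) :
    EReal.exp (((ε * t ^ ε : ℝ) : EReal) *
        extIntegral μ (V ⁻¹' Set.Ici t) (fun y => V y ^ (-ε - 1) * Real.log (f y))) ^ p ≤
      ENNReal.ofReal (ε * t ^ ε * (t ^ (-γ) * Real.exp (-(γ / ε)))) *
        ∫⁻ y in V ⁻¹' Set.Ici t,
          ENNReal.ofReal (V y ^ (-ε - 1) * (f y ^ p * V y ^ γ)) ∂μ := by
  set S := V ⁻¹' Set.Ici t with hS
  have hSm : MeasurableSet S := hV.measurable measurableSet_Ici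
  have hVpos : ∀ᵐ y ∂μ.restrict S, 0 < V y :=
    (ae_restrict_mem hSm).mono fun y hy => ht.trans_le hy
  have hfS : AEMeasurable f (μ.restrict S) := hf.restrict
  have hVS : AEMeasurable V (μ.restrict S) := hV.measurable.aemeasurable
  have hc : 0 < ε * t ^ ε := by positivity
  by_cases hfin : ∫⁻ y in S, ENNReal.ofReal (V y ^ (-ε - 1) * (f y ^ p * V y ^ γ)) ∂μ = ⊤
  · rw [hfin, ENNReal.mul_top (by simpa using by positivity)]
    exact le_top
  have hkm : AEMeasurable (fun y => V y ^ (-ε - 1) * (f y ^ p * V y ^ γ)) (μ.restrict S) := by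
    fun_prop
  have hk0 : 0 ≤ᵐ[μ.restrict S] fun y => V y ^ (-ε - 1) * (f y ^ p * V y ^ γ) := by
    filter_upwards [hVpos] with y hy
    have := hf0 y
    simp only [Pi.zero_apply]
    positivity
  have hk : IntegrableOn (fun y => V y ^ (-ε - 1) * (f y ^ p * V y ^ γ)) S μ := by
    refine ⟨hkm.aestronglyMeasurable, ?_⟩
    rw [hasFiniteIntegral_iff_ofReal hk0]
    exact Ne.lt_top hfin
  have hw := integrableOn_rpow_neg_sub_one_comp hV ht hε
  have hl := integrableOn_rpow_mul_log_comp hV ht hε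
  have hlogh : ∀ y, 0 < V y →
      Real.log (f y ^ p * V y ^ γ) = p * Real.log (f y) + γ * Real.log (V y) := fun y hy => by
    have := hf0 y
    rw [Real.log_mul (by positivity) (by positivity), Real.log_rpow this, Real.log_rpow hy]
  by_cases hg : IntegrableOn (fun y => V y ^ (-ε - 1) * Real.log (f y)) S μ
  · rw [extIntegral_of_integrableOn hg, ← EReal.coe_mul, EReal.exp_coe,
      ENNReal.ofReal_rpow_of_pos (Real.exp_pos _), ← Real.exp_mul,
      ← ofReal_integral_eq_lintegral_ofReal hk hk0, ← ENNReal.ofReal_mul (by positivity)]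
    refine ENNReal.ofReal_le_ofReal ?_
    set B := ∫ y in S, V y ^ (-ε - 1) * Real.log (f y) ∂μ with hB
    have hwlog : ∀ᵐ y ∂μ.restrict S, ε * t ^ ε * V y ^ (-ε - 1) *
        Real.log (f y ^ p * V y ^ γ) = ε * t ^ ε * p * (V y ^ (-ε - 1) * Real.log (f y)) +
          ε * t ^ ε * γ * (V y ^ (-ε - 1) * Real.log (V y)) := by
      filter_upwards [hVpos] with y hy
      rw [hlogh y hy]
      ring
    have htt : t ^ ε * t ^ (-ε) = 1 := by
      rw [← Real.rpow_add ht, add_neg_cancel, Real.rpow_zero]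
    have hlogint : ∫ y in S, ε * t ^ ε * V y ^ (-ε - 1) * Real.log (f y ^ p * V y ^ γ) ∂μ =
        ε * t ^ ε * B * p + γ * (Real.log t + 1 / ε) := by
      rw [integral_congr_ae hwlog, integral_add (hg.const_mul _) (hl.const_mul _),
        integral_const_mul, integral_const_mul, setIntegral_rpow_mul_log_comp hV ht hε, ← hB]
      calc _ = ε * t ^ ε * B * p +
            (t ^ ε * t ^ (-ε)) * (ε / ε) * γ * (Real.log t + 1 / ε) := by ring
        _ = _ := by rw [htt, div_self hε.ne']; ring
    have hJ := exp_integral_mul_log_le (μ := μ.restrict S)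
      (w := fun y => ε * t ^ ε * V y ^ (-ε - 1)) (h := fun y => f y ^ p * V y ^ γ)
      (hVpos.mono fun y hy => by positivity) (hw.const_mul _)
      (by
        rw [integral_const_mul, setIntegral_rpow_neg_sub_one_comp hV ht hε]
        calc _ = (t ^ ε * t ^ (-ε)) * (ε / ε) := by ring
          _ = 1 := by rw [htt, div_self hε.ne', one_mul])
      (hVpos.mono fun y hy => by
        have := hf0 y
        positivity)
      (((hg.const_mul _).add (hl.const_mul _)).congr (hwlog.mono fun y hy => hy.symm))
      ((hk.const_mul (ε * t ^ ε)).congr (ae_of_all _ fun y => by simp [mul_assoc]))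
    simp only [mul_assoc (ε * t ^ ε)] at hJ hlogint
    rw [hlogint, integral_const_mul] at hJ
    -- The weight `V^γ` adds `γ (log t + 1/ε)` to the mean of the logarithm; the prefactor `t^(-γ)
    -- exp(-γ/ε)` removes it.
    have hexp : Real.exp (ε * t ^ ε * B * p) =
        t ^ (-γ) * Real.exp (-(γ / ε)) *
          Real.exp (ε * t ^ ε * (B * p) + γ * (Real.log t + 1 / ε)) := by
      rw [Real.rpow_def_of_pos ht (-γ), ← Real.exp_add, ← Real.exp_add]
      ring_nf
    rw [hexp]
    calc _ ≤ t ^ (-γ) * Real.exp (-(γ / ε)) * _ :=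
          mul_le_mul_of_nonneg_left hJ (by positivity)
      _ = _ := by ring
  -- Since `log z ≤ z` for `z = f^p V^γ`, the positive part of the integrand has finite integral.
  -- Non-integrability can then only come from the negative part, so the extended integral is `-∞`
  -- and its exponential is `0`.
  · rw [extIntegral_eq_bot (by fun_prop) ?_ hg, EReal.coe_mul_bot_of_pos hc, EReal.exp_bot,
      ENNReal.zero_rpow_of_pos hp]
    · exact zero_le
    · refine ((lintegral_mono_ae ?_).trans_lt
        (((hk.sub (hl.const_mul γ)).const_mul (1 / p)).lintegral_lt_top)).ne
      filter_upwards [hVpos] with y hy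
      refine ENNReal.ofReal_le_ofReal ?_
      have := hf0 y
      have h1 := Real.log_le_self (show 0 ≤ f y ^ p * V y ^ γ by positivity)
      rw [hlogh y hy] at h1
      have h2 : Real.log (f y) ≤ 1 / p * (f y ^ p * V y ^ γ - γ * Real.log (V y)) := by
        rw [div_mul_eq_mul_div, one_mul, le_div_iff₀ hp]
        linarith
      calc _ ≤ _ := mul_le_mul_of_nonneg_left h2 (Real.rpow_nonneg hy.le _)
        _ = _ := by
          simp only [Pi.sub_apply]
          ring

/-! ### Minkowski's inequality for tail integrals -/

theorem lintegral_mul_setLIntegral_Ici [SFinite μ] (hV : Measurable V) {u : ℝ → ℝ≥0∞}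
    (hu : Measurable u) {k : X → ℝ≥0∞} (hk : AEMeasurable k μ) :
    ∫⁻ t in Set.Ioi 0, u t * ∫⁻ y in V ⁻¹' Set.Ici t, k y ∂μ =
      ∫⁻ y, (k y * ∫⁻ t in Set.Ioc 0 (V y), u t) ∂μ := by
  let Φ : ℝ → X → ℝ≥0∞ := fun t y => {z : ℝ × X | z.1 ≤ V z.2}.indicator
    (fun z => u z.1 * k z.2) (t, y)
  have hΦ : AEMeasurable (Function.uncurry Φ) ((volume.restrict (Set.Ioi 0)).prod μ) :=
    AEMeasurable.indicator ((hu.comp measurable_fst).aemeasurable.mul hk.comp_snd)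
      (measurableSet_le measurable_fst (hV.comp measurable_snd))
  calc ∫⁻ t in Set.Ioi 0, u t * ∫⁻ y in V ⁻¹' Set.Ici t, k y ∂μ =
        ∫⁻ t in Set.Ioi 0, ∫⁻ y, Φ t y ∂μ := by
        congr 1 with t
        rw [← lintegral_const_mul'' _ hk.restrict,
          ← lintegral_indicator (hV measurableSet_Ici)]
        rfl
    _ = ∫⁻ y, ∫⁻ t in Set.Ioi 0, Φ t y ∂volume ∂μ := lintegral_lintegral_swap hΦ
    _ = _ := by
        congr 1 with y
        rw [← lintegral_const_mul _ hu, show Set.Ioc 0 (V y) = Set.Iic (V y) ∩ Set.Ioi 0 by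
          ext; simp [and_comm], ← Measure.restrict_restrict measurableSet_Iic,
          ← lintegral_indicator measurableSet_Iic]
        congr 1 with t
        simp only [Φ, Set.indicator, Set.mem_ofPred_eq, Set.mem_Iic, mul_comm]

/-- Minkowski's inequality for the tail integrals of a weighted function. -/
theorem lintegral_rpow_mul_setLIntegral_Ici_rpow_le [SFinite μ] (hV : Measurable V)
    (hVpos : ∀ᵐ y ∂μ, 0 < V y) {r ε : ℝ} (hr : 1 ≤ r) (hε : 0 < ε) {F : X → ℝ≥0∞}
    (hF : AEMeasurable F μ) :
    ∫⁻ t in Set.Ioi 0, ENNReal.ofReal (t ^ (ε * r - 1)) *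
        (∫⁻ y in V ⁻¹' Set.Ici t, ENNReal.ofReal (V y ^ (-ε)) * F y ∂μ) ^ r ≤
      ENNReal.ofReal ((ε * r)⁻¹) * (∫⁻ y, F y ∂μ) ^ r := by
  have hr0 : 0 < r := by linarith
  have hβ : 0 < ε * r := by positivity
  set A := ∫⁻ y, F y ∂μ with hA
  set k : X → ℝ≥0∞ := fun y => ENNReal.ofReal (V y ^ (-ε)) * F y with hk
  set H : ℝ → ℝ≥0∞ := fun t => ∫⁻ y in V ⁻¹' Set.Ici t, k y ∂μ with hH
  set w : ℝ → ℝ≥0∞ := fun t => ENNReal.ofReal (t ^ (ε * r - 1)) with hw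
  set I := ∫⁻ t in Set.Ioi 0, w t * H t ^ r with hI
  change I ≤ _
  by_cases hAtop : A = ⊤
  · rw [hAtop, ENNReal.top_rpow_of_pos hr0, ENNReal.mul_top (by simpa using by positivity)]
    exact le_top
  have hkm : AEMeasurable k μ := by fun_prop
  have hHanti : Antitone H := fun s t hst =>
    lintegral_mono_set (Set.preimage_mono (Set.Ici_subset_Ici.2 hst))
  have hHm : Measurable H := hHanti.measurable
  have hwm : Measurable w := by fun_prop
  have hHr : ∀ t, H t ^ r = H t ^ (r - 1) * H t := fun t => by
    conv_lhs => rw [← sub_add_cancel r 1,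
      ENNReal.rpow_add_of_nonneg _ _ (by linarith) zero_le_one, ENNReal.rpow_one]
  -- On `{V ≥ t}` one has `t^ε V^(-ε) ≤ 1`.
  have hHle : ∀ t, 0 < t → ENNReal.ofReal (t ^ ε) * H t ≤ A := by
    intro t ht
    rw [hH, ← lintegral_const_mul'' _ hkm.restrict, hA]
    refine (setLIntegral_mono_ae' (g := F) (hV measurableSet_Ici)
      (ae_of_all _ fun y hy => ?_)).trans (setLIntegral_le_lintegral _ _)
    have hVy : 0 < V y := ht.trans_le hy
    rw [hk, ← mul_assoc, ← ENNReal.ofReal_mul (by positivity), Real.rpow_neg hVy.le]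
    refine mul_le_of_le_one_left zero_le ?_
    rw [← ENNReal.ofReal_one]
    refine ENNReal.ofReal_le_ofReal ?_
    rw [← div_eq_mul_inv, div_le_one (by positivity)]
    exact Real.rpow_le_rpow ht.le hy hε.le
  have hkcancel : ∀ᵐ y ∂μ, ∀ c : ℝ, k y * ENNReal.ofReal (V y ^ ε * c) =
      ENNReal.ofReal c * F y := by
    filter_upwards [hVpos] with y hy c
    rw [hk, mul_right_comm, ← ENNReal.ofReal_mul (by positivity), ← mul_assoc,
      ← Real.rpow_add hy, neg_add_cancel, Real.rpow_zero, one_mul]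
  -- Finiteness is needed to divide by `I^(1-1/r)` below. Bounding `H^(r-1)` by `(A t^(-ε))^(r-1)`
  -- leaves an integral linear in `H`, which Tonelli evaluates.
  have hItop : I ≠ ⊤ := by
    have hle : I ≤ ∫⁻ t in Set.Ioi 0,
        (A ^ (r - 1) * ENNReal.ofReal (t ^ (ε - 1))) * H t := by
      refine setLIntegral_mono' measurableSet_Ioi fun t ht => ?_
      have ht' : 0 < t := ht
      calc w t * H t ^ r = (ENNReal.ofReal (t ^ ε) * H t) ^ (r - 1) *
            ENNReal.ofReal (t ^ (ε - 1)) * H t := by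
            simp only [hHr, hw]
            rw [ENNReal.mul_rpow_of_nonneg _ _ (by linarith : 0 ≤ r - 1),
              ENNReal.ofReal_rpow_of_pos (by positivity), ← Real.rpow_mul ht'.le,
              show ε * r - 1 = ε * (r - 1) + (ε - 1) by ring, Real.rpow_add ht',
              ENNReal.ofReal_mul (by positivity)]
            ring
        _ ≤ _ := by
            gcongr
            exact hHle t ht'
    refine (hle.trans_lt ?_).ne
    rw [lintegral_mul_setLIntegral_Ici hV (by fun_prop) hkm]
    have hinner : ∀ᵐ y ∂μ, k y * ∫⁻ t in Set.Ioc 0 (V y),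
        A ^ (r - 1) * ENNReal.ofReal (t ^ (ε - 1)) =
          A ^ (r - 1) * ENNReal.ofReal ε⁻¹ * F y := by
      filter_upwards [hVpos, hkcancel] with y hy hc
      rw [lintegral_const_mul _ (by fun_prop), setLIntegral_Ioc_rpow hε hy.le, mul_left_comm,
        div_eq_mul_inv, hc, mul_assoc]
    rw [lintegral_congr_ae hinner, lintegral_const_mul'' _ hF]
    exact ENNReal.mul_lt_top (ENNReal.mul_lt_top
      (ENNReal.rpow_lt_top_of_nonneg (by linarith) hAtop) ENNReal.ofReal_lt_top)
      (Ne.lt_top hAtop)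
  have hr1 : 0 ≤ 1 - 1 / r := by
    rw [sub_nonneg, div_le_one hr0]
    exact hr
  -- Write `H^r = H^(r-1) H`, exchange the integrals, and apply Hölder on `(0, V y]`. The norm of
  -- the indicator of `(0, v]` in `L^r(w)` is `v^ε (εr)^(-1/r)`, whose power of `v` cancels the
  -- factor `V^(-ε)` in `k`.
  have hmain : I ≤ ENNReal.ofReal ((ε * r)⁻¹ ^ (1 / r)) * A * I ^ (1 - 1 / r) := by
    have hhold : ∀ v, 0 < v → ∫⁻ t in Set.Ioc 0 v, w t * H t ^ (r - 1) ≤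
        ENNReal.ofReal (v ^ ε * (ε * r)⁻¹ ^ (1 / r)) * I ^ (1 - 1 / r) := by
      intro v hv
      calc _ = ∫⁻ t in Set.Ioc 0 v, w t ^ (1 / r) * (w t * H t ^ r) ^ (1 - 1 / r) := by
            refine setLIntegral_congr_fun measurableSet_Ioc fun t ht => ?_
            rw [ENNReal.mul_rpow_of_nonneg _ _ hr1, ← ENNReal.rpow_mul, ← mul_assoc,
              ← ENNReal.rpow_add_of_nonneg _ _ (by positivity) hr1, add_sub_cancel,
              ENNReal.rpow_one, mul_sub, mul_one, mul_one_div_cancel hr0.ne']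
        _ ≤ (∫⁻ t in Set.Ioc 0 v, w t) ^ (1 / r) *
            (∫⁻ t in Set.Ioc 0 v, w t * H t ^ r) ^ (1 - 1 / r) :=
          ENNReal.lintegral_mul_norm_pow_le (by fun_prop) (by fun_prop) (by positivity) hr1
            (by ring)
        _ ≤ _ := by
            rw [hw, setLIntegral_Ioc_rpow hβ hv.le, ENNReal.ofReal_rpow_of_pos (by positivity),
              div_eq_mul_inv, Real.mul_rpow (by positivity) (by positivity), ← Real.rpow_mul hv.le,
              show ε * r * (1 / r) = ε by field_simp]
            gcongr
            exact lintegral_mono_set Set.Ioc_subset_Ioi_self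
    calc I = ∫⁻ t in Set.Ioi 0, (w t * H t ^ (r - 1)) * H t := by
          simp only [hI, hHr, mul_assoc]
      _ = ∫⁻ y, (k y * ∫⁻ t in Set.Ioc 0 (V y), w t * H t ^ (r - 1)) ∂μ :=
          lintegral_mul_setLIntegral_Ici hV (by fun_prop) hkm
      _ ≤ ∫⁻ y, ENNReal.ofReal ((ε * r)⁻¹ ^ (1 / r)) * I ^ (1 - 1 / r) * F y ∂μ := by
          refine lintegral_mono_ae ?_
          filter_upwards [hVpos, hkcancel] with y hy hc
          refine (mul_le_mul_right (hhold _ hy) _).trans_eq ?_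
          rw [← mul_assoc, hc]
          ring
      _ = _ := by
          rw [lintegral_const_mul'' _ hF]
          ring
  by_cases hI0 : I = 0
  · rw [hI0]
    exact zero_le
  have hsplit : I = I ^ (1 / r) * I ^ (1 - 1 / r) := by
    rw [← ENNReal.rpow_add_of_nonneg _ _ (by positivity) hr1, add_sub_cancel, ENNReal.rpow_one]
  have hroot : I ^ (1 / r) ≤ ENNReal.ofReal ((ε * r)⁻¹ ^ (1 / r)) * A := by
    nth_rewrite 1 [hsplit] at hmain
    exact (ENNReal.mul_le_mul_iff_left
      (by simp [hI0, hItop]) (ENNReal.rpow_ne_top_of_nonneg hr1 hItop)).1 hmain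
  calc I = (I ^ (1 / r)) ^ r := by
        rw [← ENNReal.rpow_mul, one_div_mul_cancel hr0.ne', ENNReal.rpow_one]
    _ ≤ (ENNReal.ofReal ((ε * r)⁻¹ ^ (1 / r)) * A) ^ r := by gcongr
    _ = _ := by
        rw [ENNReal.mul_rpow_of_nonneg _ _ hr0.le, ENNReal.ofReal_rpow_of_pos (by positivity),
          ← Real.rpow_mul (by positivity), one_div_mul_cancel hr0.ne', Real.rpow_one]

/-! ### The upper bound -/

/-- The exponential mean of `f` over the superlevel sets of `V`. -/
noncomputable def expMean (μ : Measure X) (V : X → ℝ) (ε : ℝ) (f : X → ℝ) (x : X) : ℝ≥0∞ :=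
  EReal.exp (((ε * V x ^ ε : ℝ) : EReal) *
    extIntegral μ (V ⁻¹' Set.Ici (V x)) (fun y => V y ^ (-ε - 1) * Real.log (f y)))

/-- Jensen is used with `γ = b + 1`, so that `V^(-ε-1) f^p V^γ = V^(-ε) (f^p V^b)`. The exponent
relation reads `(b+1) q/p = a+1` and turns the outer power into `t^(ε q/p - 1)`, the one in
Minkowski's inequality. -/
theorem lintegral_expMean_rpow_le [SFinite μ]
    (hV : MeasurePreserving V μ (volume.restrict (Set.Ioi 0))) {p q a b ε : ℝ} (hp : 0 < p)
    (hpq : p ≤ q) (hε : 0 < ε) (hab : p * (a + 1) - q * (b + 1) = 0) {f : X → ℝ}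
    (hf : AEMeasurable f μ) (hf0 : ∀ x, 0 < f x) :
    ∫⁻ x, expMean μ V ε f x ^ q * ENNReal.ofReal (V x ^ a) ∂μ ≤
      ENNReal.ofReal ((ε * Real.exp (-((b + 1) / ε))) ^ (q / p) * (ε * (q / p))⁻¹) *
        (∫⁻ x, ENNReal.ofReal (f x ^ p * V x ^ b) ∂μ) ^ (q / p) := by
  have hVm := hV.measurable
  set r := q / p with hr
  have hr1 : 1 ≤ r := (one_le_div hp).2 hpq
  have hr0 : 0 < r := by linarith
  have hpr : p * r = q := by
    rw [hr]
    field_simp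
  have hexp : (b + 1) * r = a + 1 := by
    rw [hr, ← mul_div_assoc, div_eq_iff hp.ne']
    linarith
  set F : X → ℝ≥0∞ := fun x => ENNReal.ofReal (f x ^ p * V x ^ b) with hF
  have hFm : AEMeasurable F μ := by fun_prop
  set H : ℝ → ℝ≥0∞ := fun t => ∫⁻ y in V ⁻¹' Set.Ici t, ENNReal.ofReal (V y ^ (-ε)) * F y ∂μ
    with hH
  have hHanti : Antitone H := fun s t hst =>
    lintegral_mono_set (Set.preimage_mono (Set.Ici_subset_Ici.2 hst))
  have hHm : Measurable H := hHanti.measurable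
  have hle : ∀ᵐ x ∂μ, expMean μ V ε f x ^ q * ENNReal.ofReal (V x ^ a) ≤
      ENNReal.ofReal ((ε * Real.exp (-((b + 1) / ε))) ^ r) *
        (ENNReal.ofReal (V x ^ (ε * r - 1)) * H (V x) ^ r) := by
    filter_upwards [hV.ae_pos] with x hx
    have hHx : ∫⁻ y in V ⁻¹' Set.Ici (V x),
        ENNReal.ofReal (V y ^ (-ε - 1) * (f y ^ p * V y ^ (b + 1))) ∂μ = H (V x) := by
      refine setLIntegral_congr_fun (hVm measurableSet_Ici) fun y hy => ?_
      have hy0 : 0 < V y := hx.trans_le hy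
      simp only [hF]
      rw [← ENNReal.ofReal_mul (by positivity), Real.rpow_add hy0, Real.rpow_sub hy0,
        Real.rpow_one]
      field_simp
    calc _ = (expMean μ V ε f x ^ p) ^ r * ENNReal.ofReal (V x ^ a) := by
          rw [← ENNReal.rpow_mul, hpr]
      _ ≤ (ENNReal.ofReal (ε * V x ^ ε * (V x ^ (-(b + 1)) * Real.exp (-((b + 1) / ε)))) *
            H (V x)) ^ r * ENNReal.ofReal (V x ^ a) := by
          rw [← hHx]
          gcongr
          exact exp_extIntegral_rpow_le hV (b + 1) hx hε hp hf hf0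
      _ = _ := by
          rw [ENNReal.mul_rpow_of_nonneg _ _ hr0.le, ENNReal.ofReal_rpow_of_pos (by positivity),
            mul_right_comm, ← ENNReal.ofReal_mul (by positivity),
            ← mul_assoc (ENNReal.ofReal ((ε * Real.exp (-((b + 1) / ε))) ^ r)),
            ← ENNReal.ofReal_mul (by positivity)]
          congr 2
          rw [show ε * V x ^ ε * (V x ^ (-(b + 1)) * Real.exp (-((b + 1) / ε))) =
            (ε * Real.exp (-((b + 1) / ε))) * (V x ^ ε * V x ^ (-(b + 1))) by ring,
            ← Real.rpow_add hx, Real.mul_rpow (by positivity) (by positivity),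
            ← Real.rpow_mul hx.le, mul_assoc, ← Real.rpow_add hx,
            show (ε + -(b + 1)) * r + a = ε * r - 1 by linarith]
  refine (lintegral_mono_ae hle).trans ?_
  rw [lintegral_const_mul _ (by fun_prop), hV.lintegral_comp
    (f := fun t => ENNReal.ofReal (t ^ (ε * r - 1)) * H t ^ r) (by fun_prop),
    ENNReal.ofReal_mul (by positivity), mul_assoc]
  gcongr
  exact lintegral_rpow_mul_setLIntegral_Ici_rpow_le hVm hV.ae_pos hr1 hε hFm

theorem levinCochranLee_upper [SFinite μ]
    (hV : MeasurePreserving V μ (volume.restrict (Set.Ioi 0))) {p q a b ε : ℝ} (hp : 0 < p)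
    (hpq : p ≤ q) (hε : 0 < ε) (hab : p * (a + 1) - q * (b + 1) = 0) {f : X → ℝ}
    (hf : AEMeasurable f μ) (hf0 : ∀ x, 0 < f x) :
    (∫⁻ x, expMean μ V ε f x ^ q * ENNReal.ofReal (V x ^ a) ∂μ) ^ (1 / q) ≤
      ENNReal.ofReal ((p / q) ^ (1 / q) * ε ^ (1 / p - 1 / q) *
          Real.exp (-((b + 1) / (ε * p)))) *
        (∫⁻ x, ENNReal.ofReal (f x ^ p * V x ^ b) ∂μ) ^ (1 / p) := by
  have hq : 0 < q := hp.trans_le hpq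
  refine (ENNReal.rpow_le_rpow (lintegral_expMean_rpow_le hV hp hpq hε hab hf hf0)
    (by positivity)).trans_eq ?_
  rw [ENNReal.mul_rpow_of_nonneg _ _ (by positivity), ENNReal.ofReal_rpow_of_pos (by positivity),
    ← ENNReal.rpow_mul, show q / p * (1 / q) = 1 / p by field_simp]
  congr 2
  rw [Real.mul_rpow (by positivity) (by positivity), ← Real.rpow_mul (by positivity),
    show q / p * (1 / q) = 1 / p by field_simp, Real.mul_rpow hε.le (Real.exp_pos _).le,
    ← Real.exp_mul, mul_inv, inv_div, Real.mul_rpow (by positivity) (by positivity),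
    Real.inv_rpow hε.le, Real.rpow_sub hε, show -((b + 1) / ε) * (1 / p) = -((b + 1) / (ε * p)) by
      field_simp]
  ring

/-! ### Test functions and the lower bound -/

/-- A test function: a power of `V` on `{V ≥ R}`, with constant `f ^ p * V ^ b` elsewhere. -/
noncomputable def powerTest (p b ε R δ s : ℝ) : ℝ :=
  if R ≤ s then s ^ (-((b + 1 + ε) / p)) else if 0 < s then (δ * s ^ (-b)) ^ (1 / p) else 1

theorem powerTest_pos {p b ε R δ : ℝ} (hR : 0 < R) (hδ : 0 < δ) (s : ℝ) :
    0 < powerTest p b ε R δ s := by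
  unfold powerTest
  split_ifs with h1 h2
  · have : 0 < s := hR.trans_le h1
    positivity
  · positivity
  · exact one_pos

theorem measurable_powerTest (p b ε R δ : ℝ) : Measurable (powerTest p b ε R δ) :=
  Measurable.ite measurableSet_Ici (by fun_prop)
    (Measurable.ite measurableSet_Ioi (by fun_prop) measurable_const)

/-- On `{V ≥ R}` the exponent makes `f^p V^b` equal to `V^(-1-ε)`, which is integrable at infinity
but not at `0`. The inner part replaces it by the constant `δ`, at cost `δ R`. -/
theorem lintegral_powerTest_le (hV : MeasurePreserving V μ (volume.restrict (Set.Ioi 0)))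
    {p b ε R δ : ℝ} (hp : 0 < p) (hε : 0 < ε) (hR : 0 < R) (hδ : 0 < δ) :
    ∫⁻ x, ENNReal.ofReal (powerTest p b ε R δ (V x) ^ p * V x ^ b) ∂μ ≤
      ENNReal.ofReal (δ * R + R ^ (-ε) / ε) := by
  have hm := measurable_powerTest p b ε R δ
  rw [hV.lintegral_comp (f := fun s => ENNReal.ofReal (powerTest p b ε R δ s ^ p * s ^ b))
    (by fun_prop), ← Set.Ioo_union_Ici_eq_Ioi hR]
  refine (lintegral_union_le _ _ _).trans_eq ?_
  rw [ENNReal.ofReal_add (by positivity) (by positivity), ← setLIntegral_Ioi_rpow hε hR,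
    restrict_Ioi_eq_restrict_Ici]
  congr 1
  · calc _ = ∫⁻ s in Set.Ioo 0 R, ENNReal.ofReal δ := by
          refine setLIntegral_congr_fun measurableSet_Ioo fun s hs => ?_
          have hs0 := hs.1
          simp only [powerTest, if_neg (not_le.2 hs.2), if_pos hs.1]
          rw [← Real.rpow_mul (by positivity), one_div_mul_cancel hp.ne', Real.rpow_one,
            mul_assoc, ← Real.rpow_add hs.1, neg_add_cancel, Real.rpow_zero, mul_one]
      _ = _ := by
          rw [setLIntegral_const, Real.volume_Ioo, sub_zero, ENNReal.ofReal_mul hδ.le]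
  · refine setLIntegral_congr_fun measurableSet_Ici fun s hs => ?_
    have hs0 : 0 < s := hR.trans_le hs
    simp only [powerTest, if_pos (show R ≤ s from hs)]
    rw [← Real.rpow_mul hs0.le, ← Real.rpow_add hs0]
    congr 2
    field_simp
    ring

/-- For `V x ≥ R` the mean sees only the power part of the test function, so the inner value `δ`
does not enter. -/
theorem expMean_powerTest (hV : MeasurePreserving V μ (volume.restrict (Set.Ioi 0)))
    {p b ε R δ : ℝ} (hε : 0 < ε) (hR : 0 < R) {x : X} (hx : R ≤ V x) :
    expMean μ V ε (fun y => powerTest p b ε R δ (V y)) x =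
      ENNReal.ofReal (V x ^ (-((b + 1 + ε) / p)) * Real.exp (-((b + 1 + ε) / p) / ε)) := by
  have hx0 : 0 < V x := hR.trans_le hx
  set σ := -((b + 1 + ε) / p) with hσ
  have hS : MeasurableSet (V ⁻¹' Set.Ici (V x)) := hV.measurable measurableSet_Ici
  have hcongr : ∀ y ∈ V ⁻¹' Set.Ici (V x),
      σ * (V y ^ (-ε - 1) * Real.log (V y)) =
        V y ^ (-ε - 1) * Real.log (powerTest p b ε R δ (V y)) := fun y hy => by
    have hy1 : R ≤ V y := hx.trans hy
    rw [powerTest, if_pos hy1, Real.log_rpow (hR.trans_le hy1)]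
    ring
  have hint := (integrableOn_rpow_mul_log_comp hV hx0 hε).const_mul σ
  rw [expMean, extIntegral_of_integrableOn (hint.congr
      ((ae_restrict_mem hS).mono hcongr)), ← setIntegral_congr_fun hS hcongr,
    integral_const_mul, setIntegral_rpow_mul_log_comp hV hx0 hε, ← EReal.coe_mul,
    EReal.exp_coe, Real.rpow_def_of_pos hx0 σ, ← Real.exp_add]
  congr 2
  have htt : V x ^ ε * V x ^ (-ε) = 1 := by
    rw [← Real.rpow_add hx0, add_neg_cancel, Real.rpow_zero]
  calc _ = (V x ^ ε * V x ^ (-ε)) * (ε / ε) * σ * (Real.log (V x) + 1 / ε) := by ring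
    _ = _ := by
      rw [htt, div_self hε.ne']
      ring

/-- Both parameters stay free: `R = 1` with `δ → 0` bounds the constant, while `δ = R^(-ε-1)` with
`R` arbitrary tests the scaling. -/
theorem levinCochranLee_powerTest (hV : MeasurePreserving V μ (volume.restrict (Set.Ioi 0)))
    {p q a b ε : ℝ} (hp : 0 < p) (hq : 0 < q) (hε : 0 < ε) {C : ℝ≥0}
    (hC : ∀ f : X → ℝ, AEMeasurable f μ → (∀ x, 0 < f x) →
      (∫⁻ x, expMean μ V ε f x ^ q * ENNReal.ofReal (V x ^ a) ∂μ) ^ (1 / q) ≤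
        (C : ℝ≥0∞) * (∫⁻ x, ENNReal.ofReal (f x ^ p * V x ^ b) ∂μ) ^ (1 / p))
    {R δ : ℝ} (hR : 0 < R) (hδ : 0 < δ) :
    ENNReal.ofReal (Real.exp (-((b + 1 + ε) / p) / ε)) *
        (∫⁻ s in Set.Ioi R, ENNReal.ofReal (s ^ (-((b + 1 + ε) / p) * q + a))) ^ (1 / q) ≤
      ENNReal.ofReal (C * (δ * R + R ^ (-ε) / ε) ^ (1 / p)) := by
  set σ := -((b + 1 + ε) / p) with hσ
  have h := hC (fun y => powerTest p b ε R δ (V y))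
    ((measurable_powerTest p b ε R δ).comp hV.measurable).aemeasurable
    (fun y => powerTest_pos hR hδ _)
  have hlow : ENNReal.ofReal (Real.exp (σ / ε)) ^ q *
      ∫⁻ s in Set.Ioi R, ENNReal.ofReal (s ^ (σ * q + a)) ≤
        ∫⁻ x, expMean μ V ε (fun y => powerTest p b ε R δ (V y)) x ^ q *
          ENNReal.ofReal (V x ^ a) ∂μ := by
    rw [← lintegral_const_mul _ (by fun_prop), ← (hV.restrict_Ici hR).lintegral_comp
      (f := fun s => ENNReal.ofReal (Real.exp (σ / ε)) ^ q * ENNReal.ofReal (s ^ (σ * q + a)))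
      (by fun_prop)]
    refine le_trans (le_of_eq ?_) (setLIntegral_le_lintegral (V ⁻¹' Set.Ici R) _)
    refine setLIntegral_congr_fun (hV.measurable measurableSet_Ici) fun x hx => ?_
    have hx0 : 0 < V x := hR.trans_le hx
    rw [expMean_powerTest hV hε hR hx, ← hσ, ENNReal.ofReal_mul (by positivity),
      ENNReal.mul_rpow_of_nonneg _ _ hq.le, ENNReal.ofReal_rpow_of_pos (p := q)
        (Real.rpow_pos_of_pos hx0 σ), Real.rpow_add hx0, ENNReal.ofReal_mul (by positivity),
      ← Real.rpow_mul hx0.le]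
    ring
  have h2 := (ENNReal.rpow_le_rpow hlow (by positivity : 0 ≤ 1 / q)).trans h
  rw [ENNReal.mul_rpow_of_nonneg _ _ (by positivity), ← ENNReal.rpow_mul,
    mul_one_div_cancel hq.ne', ENNReal.rpow_one] at h2
  refine h2.trans ?_
  rw [ENNReal.ofReal_mul C.coe_nonneg, ENNReal.ofReal_coe_nnreal,
    ← ENNReal.ofReal_rpow_of_pos (by positivity)]
  gcongr
  exact lintegral_powerTest_le hV hp hε hR hδ

theorem levinCochranLee_lower (hV : MeasurePreserving V μ (volume.restrict (Set.Ioi 0)))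
    {p q a b ε : ℝ} (hp : 0 < p) (hq : 0 < q) (hε : 0 < ε)
    (hab : p * (a + 1) - q * (b + 1) = 0) {C : ℝ≥0}
    (hC : ∀ f : X → ℝ, AEMeasurable f μ → (∀ x, 0 < f x) →
      (∫⁻ x, expMean μ V ε f x ^ q * ENNReal.ofReal (V x ^ a) ∂μ) ^ (1 / q) ≤
        (C : ℝ≥0∞) * (∫⁻ x, ENNReal.ofReal (f x ^ p * V x ^ b) ∂μ) ^ (1 / p)) :
    (p / q) ^ (1 / q) * ε ^ (1 / p - 1 / q) * Real.exp (-((b + 1) / (ε * p)) - 1 / p) ≤ C := by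
  have key : ∀ δ : ℝ, 0 < δ → Real.exp (-((b + 1) / (ε * p)) - 1 / p) *
      ((ε * (q / p))⁻¹) ^ (1 / q) ≤ C * (δ + 1 / ε) ^ (1 / p) := fun δ hδ => by
    have h := levinCochranLee_powerTest hV hp hq hε hC one_pos hδ
    rw [show -((b + 1 + ε) / p) * q + a = -(ε * (q / p)) - 1 by
        field_simp
        linarith,
      setLIntegral_Ioi_rpow (by positivity) one_pos, Real.one_rpow, Real.one_rpow, mul_one,
      ENNReal.ofReal_rpow_of_pos (by positivity), ← ENNReal.ofReal_mul (Real.exp_pos _).le,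
      ENNReal.ofReal_le_ofReal_iff (by positivity)] at h
    rw [show -((b + 1) / (ε * p)) - 1 / p = -((b + 1 + ε) / p) / ε by
      field_simp
      ring, ← one_div]
    exact h
  -- Positivity of the test function excludes `δ = 0`, which is reached only as a limit.
  have hlim : Filter.Tendsto (fun δ : ℝ => (C : ℝ) * (δ + 1 / ε) ^ (1 / p))
      (nhdsWithin 0 (Set.Ioi 0)) (nhds (C * (0 + 1 / ε) ^ (1 / p))) := by
    refine Filter.Tendsto.mono_left (ContinuousAt.tendsto ?_) nhdsWithin_le_nhds
    refine continuousAt_const.mul (ContinuousAt.rpow_const (by fun_prop) (Or.inl ?_))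
    positivity
  have h := ge_of_tendsto hlim (Filter.mem_of_superset self_mem_nhdsWithin fun δ hδ => key δ hδ)
  rw [zero_add, one_div ε, Real.inv_rpow hε.le, mul_inv, inv_div,
    Real.mul_rpow (by positivity) (by positivity), Real.inv_rpow hε.le, ← div_eq_mul_inv,
    le_div_iff₀ (by positivity)] at h
  refine le_of_eq_of_le ?_ h
  rw [Real.rpow_sub hε]
  ring

/-! ### Necessity of the exponent relation -/

theorem eq_zero_of_forall_rpow_le {η M : ℝ} (h : ∀ R : ℝ, 0 < R → R ^ η ≤ M) : η = 0 := by
  have key : ∀ η : ℝ, (∀ R : ℝ, 0 < R → R ^ η ≤ M) → η ≤ 0 := fun η h => by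
    by_contra! hη
    obtain ⟨R, hR, hR0⟩ := (((tendsto_rpow_atTop hη).eventually_gt_atTop M).and
      (Filter.eventually_gt_atTop 0)).exists
    exact absurd (h R hR0) (not_le.2 hR)
  refine le_antisymm (key η h) (neg_nonpos.1 (key (-η) fun R hR => ?_))
  rw [Real.rpow_neg hR.le, ← Real.inv_rpow hR.le]
  exact h _ (inv_pos.2 hR)

/-- The full tail may diverge, so only `(R, 2R]` is kept; the minimum covers both signs of `e`. -/
theorem ofReal_mul_rpow_le_setLIntegral_Ioi {R : ℝ} (e : ℝ) (hR : 0 < R) :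
    ENNReal.ofReal (min 1 (2 ^ e) * R ^ (e + 1)) ≤
      ∫⁻ s in Set.Ioi R, ENNReal.ofReal (s ^ e) := by
  calc _ = ∫⁻ s in Set.Ioc R (2 * R), ENNReal.ofReal (min 1 (2 ^ e) * R ^ e) := by
        rw [setLIntegral_const, Real.volume_Ioc, ← ENNReal.ofReal_mul (by positivity),
          Real.rpow_add_one hR.ne']
        ring_nf
    _ ≤ ∫⁻ s in Set.Ioc R (2 * R), ENNReal.ofReal (s ^ e) := by
        refine setLIntegral_mono' measurableSet_Ioc fun s hs => ENNReal.ofReal_le_ofReal ?_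
        rcases le_total 0 e with he | he
        · calc _ ≤ 1 * R ^ e := by gcongr; exact min_le_left _ _
            _ ≤ s ^ e := by
              rw [one_mul]
              exact Real.rpow_le_rpow hR.le hs.1.le he
        · calc _ ≤ 2 ^ e * R ^ e := by gcongr; exact min_le_right _ _
            _ = (2 * R) ^ e := (Real.mul_rpow zero_le_two hR.le).symm
            _ ≤ s ^ e := Real.rpow_le_rpow_of_nonpos (hR.trans hs.1) hs.2 he
    _ ≤ _ := lintegral_mono_set Set.Ioc_subset_Ioi_self

theorem levinCochranLee_exponents (hV : MeasurePreserving V μ (volume.restrict (Set.Ioi 0)))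
    {p q a b ε : ℝ} (hp : 0 < p) (hq : 0 < q) (hε : 0 < ε) {C : ℝ≥0}
    (hC : ∀ f : X → ℝ, AEMeasurable f μ → (∀ x, 0 < f x) →
      (∫⁻ x, expMean μ V ε f x ^ q * ENNReal.ofReal (V x ^ a) ∂μ) ^ (1 / q) ≤
        (C : ℝ≥0∞) * (∫⁻ x, ENNReal.ofReal (f x ^ p * V x ^ b) ∂μ) ^ (1 / p)) :
    p * (a + 1) - q * (b + 1) = 0 := by
  set σ := -((b + 1 + ε) / p) with hσ
  set e := σ * q + a with he
  set m : ℝ := min 1 (2 ^ e) with hm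
  have hm0 : 0 < m := by positivity
  -- After substitution `η = (a+1)/q - (b+1)/p`, so `η = 0` is the claim.
  set η := (e + 1) / q + ε / p with hη
  have key : ∀ R : ℝ, 0 < R → R ^ η ≤
      C * (1 + 1 / ε) ^ (1 / p) / (Real.exp (σ / ε) * m ^ (1 / q)) := fun R hR => by
    -- This `δ` makes the inner cost `δ R` scale as `R^(-ε)`, like the outer part.
    have h := levinCochranLee_powerTest hV hp hq hε hC hR
      (Real.rpow_pos_of_pos hR (-ε - 1))
    have h2 := (mul_le_mul_right (ENNReal.rpow_le_rpow
      (ofReal_mul_rpow_le_setLIntegral_Ioi e hR) (by positivity : 0 ≤ 1 / q)) _).trans h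
    rw [ENNReal.ofReal_rpow_of_pos (by positivity), ← ENNReal.ofReal_mul (Real.exp_pos _).le,
      ENNReal.ofReal_le_ofReal_iff (by positivity), ← Real.rpow_add_one hR.ne', sub_add_cancel,
      show R ^ (-ε) + R ^ (-ε) / ε = R ^ (-ε) * (1 + 1 / ε) by ring,
      Real.mul_rpow (by positivity) (by positivity), Real.mul_rpow (by positivity) (by positivity),
      ← Real.rpow_mul hR.le, ← Real.rpow_mul hR.le, mul_one_div, mul_one_div, neg_div p ε,
      Real.rpow_neg hR.le] at h2
    rw [hη, Real.rpow_add hR, le_div_iff₀ (by positivity)]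
    have hRp : 0 < R ^ (ε / p) := by positivity
    calc _ = Real.exp (σ / ε) * (m ^ (1 / q) * R ^ ((e + 1) / q)) * R ^ (ε / p) := by ring
      _ ≤ C * ((R ^ (ε / p))⁻¹ * (1 + 1 / ε) ^ (1 / p)) * R ^ (ε / p) := by gcongr
      _ = _ := by field_simp
  have h0 := eq_zero_of_forall_rpow_le key
  rw [hη, he, hσ] at h0
  field_simp at h0
  linarith

end Preserving

/-! ### Return to the group and the least constant -/

theorem conjExpMean_eq_expMean {N : ℕ} (hN : 0 < N) {G : HomogeneousGroup N} (ν : QuasiNorm G)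
    (ε : ℝ) (f : EuclideanSpace ℝ (Fin N) → ℝ) (x : EuclideanSpace ℝ (Fin N)) :
    conjExpMean ν ε f x = expMean volume ν.ballVol ε f x := by
  rw [conjExpMean, expMean, ν.compl_ball_eq hN]

/-- For each `f` with finite right-hand integral the condition on `C` is closed. If that integral is
infinite, `C ≠ 0` is needed, since `0 * ∞ = 0`. -/
theorem conjLevinCochranLee_of_mem_closure {N : ℕ} {G : HomogeneousGroup N} {ν : QuasiNorm G}
    {p q a b ε : ℝ} {C : ℝ≥0} (hC0 : C ≠ 0)
    (hC : C ∈ closure {C' : ℝ≥0 | ConjLevinCochranLee ν p q a b ε C'}) :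
    ConjLevinCochranLee ν p q a b ε C := by
  intro f hf hf0
  set J := (∫⁻ x, ENNReal.ofReal (f x ^ p * ν.ballVol x ^ b)) ^ (1 / p) with hJ
  by_cases hJtop : J = ⊤
  · rw [hJtop, ENNReal.mul_top (by simpa using hC0)]
    exact le_top
  · refine closure_minimal (t := {C' : ℝ≥0 | (∫⁻ x, conjExpMean ν ε f x ^ q *
      ENNReal.ofReal (ν.ballVol x ^ a)) ^ (1 / q) ≤ (C' : ℝ≥0∞) * J})
      (fun C' (hC' : ConjLevinCochranLee ν p q a b ε C') => hC' f hf hf0) ?_ hC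
    exact isClosed_le continuous_const
      ((ENNReal.continuous_mul_const hJtop).comp ENNReal.continuous_coe)

theorem theorem3p4 {N : ℕ} (hN : 0 < N) (G : HomogeneousGroup N) (ν : QuasiNorm G)
    (p q a b ε : ℝ) (hp : 0 < p) (hpq : p ≤ q) (hε : 0 < ε) :
    ((∃ C : ℝ≥0, ConjLevinCochranLee ν p q a b ε C) ↔ p * (a + 1) - q * (b + 1) = 0) ∧
    (p * (a + 1) - q * (b + 1) = 0 →
      ∃ C : ℝ≥0, IsLeast {C' : ℝ≥0 | ConjLevinCochranLee ν p q a b ε C'} C ∧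
        (p / q) ^ (1 / q) * ε ^ (1 / p - 1 / q) * Real.exp (-((b + 1) / (ε * p)) - 1 / p)
          ≤ (C : ℝ) ∧
        (C : ℝ) ≤ (p / q) ^ (1 / q) * ε ^ (1 / p - 1 / q) *
          Real.exp (-((b + 1) / (ε * p)))) := by
  have hq : 0 < q := hp.trans_le hpq
  have hV := ν.measurePreserving_ballVol hN
  set K : ℝ := (p / q) ^ (1 / q) * ε ^ (1 / p - 1 / q) * Real.exp (-((b + 1) / (ε * p))) with hK
  set L : ℝ := (p / q) ^ (1 / q) * ε ^ (1 / p - 1 / q) *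
    Real.exp (-((b + 1) / (ε * p)) - 1 / p) with hL
  have hK0 : 0 ≤ K := by positivity
  have hL0 : 0 < L := by positivity
  have hupper : p * (a + 1) - q * (b + 1) = 0 →
      ConjLevinCochranLee ν p q a b ε K.toNNReal := fun hab f hf hf0 => by
    simp only [conjExpMean_eq_expMean hN]
    exact levinCochranLee_upper hV hp hpq hε hab hf hf0
  have hlower : p * (a + 1) - q * (b + 1) = 0 → ∀ C : ℝ≥0,
      ConjLevinCochranLee ν p q a b ε C → L ≤ C := fun hab C hC => by
    refine levinCochranLee_lower hV hp hq hε hab fun f hf hf0 => ?_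
    simpa only [conjExpMean_eq_expMean hN] using hC f hf hf0
  refine ⟨⟨fun ⟨C, hC⟩ => levinCochranLee_exponents hV hp hq hε (C := C) fun f hf hf0 => ?_,
    fun hab => ⟨_, hupper hab⟩⟩, fun hab => ?_⟩
  · simpa only [conjExpMean_eq_expMean hN] using hC f hf hf0
  · set S := {C' : ℝ≥0 | ConjLevinCochranLee ν p q a b ε C'} with hS
    have hne : S.Nonempty := ⟨_, hupper hab⟩
    -- Besides the lower estimate, this gives `sInf S ≠ 0`, which the closure argument requires.
    have hLle : L.toNNReal ≤ sInf S :=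
      le_csInf hne fun C hC => Real.toNNReal_le_iff_le_coe.2 (hlower hab C hC)
    refine ⟨sInf S, ⟨conjLevinCochranLee_of_mem_closure
      ((Real.toNNReal_pos.2 hL0).trans_le hLle).ne' (csInf_mem_closure hne (OrderBot.bddBelow S)),
      fun C hC => csInf_le' hC⟩, Real.toNNReal_le_iff_le_coe.1 hLle, ?_⟩
    exact (NNReal.coe_le_coe.2 (csInf_le' (hupper hab))).trans_eq (Real.coe_toNNReal _ hK0)
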